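/- All graphs are finite and simple, and the graph with no vertices is allowed. For graphs $G$ and $H$, the strong product $G \boxtimes H$ has vertex set $V(G)\times V(H)$, and distinct vertices $(a,v),(b,u)$ are adjacent if and only if ($a=b$ or $ab\in E(G)$) and ($v=u$ or $vu\in E(H)$). A tree-decomposition of $G$ consists of a tree $T$ and bags $B_x\subseteq V(G)$ for $x \in V(T)$ such that for each $v\in V(G)$ the set $\{x\in V(T): v\in B_x\}$ induces a non-empty connected subgraph of $T$, and for each edge $uv\in E(G)$ some bag contains both $u$ and $v$; its width is $\max_{x}(|B_x|-1)$. The treewidth $\mathrm{tw}(G)$ is the minimum width of a tree-decomposition of $G$ (so the graph with no vertices has treewidth $-1$). The Hadwiger number $\eta(H)$ is the maximum integer $t\ge 0$ such that the complete graph $K_t$ is a minor of $H$, that is, a graph isomorphic to $K_t$ can be obtained from $H$ by vertex deletions, edge deletions and edge contractions. For all graphs $G$ and $H$, $$\mathrm{tw}(G\boxtimes H)\ \geq\ \eta(H)\,(\mathrm{tw}(G)+1)-1 .$$ Consequently, for every graph $G$ and every integer $n\ge 0$, $$\mathrm{tw}(G\boxtimes K_n)\ =\ (\mathrm{tw}(G)+1)\,n-1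 .$$ -/

import Mathlib

universe u v

namespace SimpleGraph

/-! ### Graph products -/

/-- The direct product `G × H`: `(a, x)` and `(b, y)` are adjacent iff `ab ∈ E(G)` and
`xy ∈ E(H)`. -/
def directProd {V : Type u} {W : Type v} (G : SimpleGraph V) (H : SimpleGraph W) :
    SimpleGraph (V × W) where
  Adj p q := G.Adj p.1 q.1 ∧ H.Adj p.2 q.2
  symm := ⟨fun _ _ h => ⟨h.1.symm, h.2.symm⟩⟩
  loopless := ⟨fun _ h => G.irrefl h.1⟩

/-- The strong product `G ⊠ H`: the union of the cartesian product and the direct product. -/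
def strongProd {V : Type u} {W : Type v} (G : SimpleGraph V) (H : SimpleGraph W) :
    SimpleGraph (V × W) :=
  (G □ H) ⊔ directProd G H

/-! ### Tree-decompositions and treewidth -/

/-- An `H`-decomposition of `G`, for an arbitrary graph `H` on a set `ι` of nodes. -/
structure Decomposition {V : Type u} {ι : Type v} (G : SimpleGraph V) (H : SimpleGraph ι) where
  /-- The bag of a node. -/
  bag : ι → Finset V
  /-- The nodes whose bags contain a given vertex induce a non-empty connected subgraph. -/
  connected : ∀ a : V, (H.induce {x | a ∈ bag x}).Connected
  /-- Both ends of each edge lie in a common bag. -/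
  edge : ∀ a b : V, G.Adj a b → ∃ x, a ∈ bag x ∧ b ∈ bag x

/-- The width of a decomposition: the maximum of `|B_x| - 1` over all nodes `x`. It is an integer;
it equals `-1` if every bag is empty. -/
def Decomposition.width {V : Type u} {ι : Type v} [Fintype ι] {G : SimpleGraph V}
    {H : SimpleGraph ι} (D : Decomposition G H) : ℤ :=
  ((Finset.univ.sup fun x => (D.bag x).card : ℕ) : ℤ) - 1

/-- The widths of the tree-decompositions of `G`. The nodes of a (finite, non-empty) tree are
taken without loss of generality to be `0, …, m - 1`. -/
def treeDecompositionWidths {V : Type u} (G : SimpleGraph V) : Set ℤ :=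
  {w | ∃ (m : ℕ) (T : SimpleGraph (Fin m)) (D : Decomposition G T), T.IsTree ∧ D.width = w}

/-- The treewidth of a finite graph `G`: the minimum width of a tree-decomposition of `G`.
The graph without vertices has treewidth `-1`. -/
noncomputable def treewidth {V : Type u} (G : SimpleGraph V) : ℤ :=
  sInf G.treeDecompositionWidths

/-- For a finite graph the minimum in the definition of treewidth is attained. -/
theorem isLeast_treewidth {V : Type u} [Finite V] (G : SimpleGraph V) :
    IsLeast G.treeDecompositionWidths G.treewidth := by
  have hb : BddBelow G.treeDecompositionWidths := by
    refine ⟨-1, ?_⟩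
    rintro w ⟨m, T, D, -, rfl⟩
    unfold Decomposition.width
    omega
  have hn : G.treeDecompositionWidths.Nonempty := by
    have := Fintype.ofFinite V
    let D : Decomposition G (⊥ : SimpleGraph (Fin 1)) :=
      { bag := fun _ => Finset.univ
        connected := fun a => by
          have : Nonempty {x : Fin 1 | a ∈ (Finset.univ : Finset V)} := ⟨⟨0, by simp⟩⟩
          exact Connected.mk fun x y => by
            rw [Subsingleton.elim x y]
        edge := fun a b _ => ⟨0, by simp, by simp⟩ }
    exact ⟨D.width, 1, ⊥, D, IsTree.of_subsingleton, rfl⟩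
  exact ⟨Int.csInf_mem hn hb, fun w hw => csInf_le hb hw⟩

/-! ### Minors and the Hadwiger number -/

/-- Contraction of the edge `ab` of `G`: the vertex `b` is removed, and `a`, which represents the
contracted edge, inherits the neighbours of `b`; no loop or parallel edge is kept. -/
def contractEdge {V : Type u} (G : SimpleGraph V) (a b : V) : SimpleGraph {x : V // x ≠ b} :=
  SimpleGraph.fromRel fun x y => G.Adj x y ∨ (x.1 = a ∧ G.Adj b y)

/-- `IsMinor H G`: a graph isomorphic to `H` can be obtained from `G` by a finite sequence of vertex
deletions, edge deletions and edge contractions. -/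
inductive IsMinor {W : Type v} (H : SimpleGraph W) : {V : Type u} → SimpleGraph V → Prop
  | iso {V : Type u} {G : SimpleGraph V} (e : H ≃g G) : IsMinor H G
  | deleteVertex {V : Type u} {G : SimpleGraph V} (a : V)
      (h : IsMinor H (G.induce {x | x ≠ a})) : IsMinor H G
  | deleteEdge {V : Type u} {G : SimpleGraph V} (a b : V) (hab : G.Adj a b)
      (h : IsMinor H (G.deleteEdges {s(a, b)})) : IsMinor H G
  | contractEdge {V : Type u} {G : SimpleGraph V} (a b : V) (hab : G.Adj a b)
      (h : IsMinor H (G.contractEdge a b)) : IsMinor H G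

/-- The Hadwiger number `η(G)` of a finite graph `G`: the maximum `t` such that the complete graph
`K_t` is a minor of `G`. -/
noncomputable def hadwigerNumber {V : Type u} (G : SimpleGraph V) : ℕ :=
  sSup {t : ℕ | IsMinor (⊤ : SimpleGraph (Fin t)) G}

/-- A minor of a finite graph has at most as many vertices as the graph. -/
theorem IsMinor.card_le {W : Type v} {H : SimpleGraph W} {V : Type u} {G : SimpleGraph V}
    (h : IsMinor H G) : Finite V → Nat.card W ≤ Nat.card V := by
  induction h with
  | iso e => intro _; exact (Nat.card_congr e.toEquiv).le
  | deleteVertex a _ ih =>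
    intro _
    exact (ih inferInstance).trans (Nat.card_le_card_of_injective _ Subtype.val_injective)
  | deleteEdge a b _ _ ih => exact ih
  | contractEdge a b _ _ ih =>
    intro _
    exact (ih inferInstance).trans (Nat.card_le_card_of_injective _ Subtype.val_injective)

/-- The graph without vertices is a minor of every finite graph. -/
theorem isMinor_of_isEmpty {W : Type v} [IsEmpty W] (H : SimpleGraph W) (n : ℕ) :
    ∀ {V : Type u} [Finite V] (G : SimpleGraph V), Nat.card V = n → IsMinor H G := by
  induction n with
  | zero =>
    intro V _ G hV
    have : IsEmpty V := Finite.card_eq_zero_iff.mp hV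
    exact .iso ⟨Equiv.equivOfIsEmpty W V, fun {a} => isEmptyElim a⟩
  | succ n ih =>
    intro V _ G hV
    have hne : Nonempty V := (Nat.card_pos_iff.mp (by omega)).1
    obtain ⟨a⟩ := hne
    refine .deleteVertex a (ih _ ?_)
    have h1 := Set.ncard_add_ncard_compl ({a} : Set V)
    rw [Set.ncard_singleton, hV] at h1
    have h2 : Nat.card {x : V | x ≠ a} = ({a}ᶜ : Set V).ncard := rfl
    omega

/-- For a finite graph the maximum in the definition of the Hadwiger number is attained. -/
theorem isGreatest_hadwigerNumber {V : Type u} [Finite V] (G : SimpleGraph V) :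
    IsGreatest {t : ℕ | IsMinor (⊤ : SimpleGraph (Fin t)) G} G.hadwigerNumber := by
  have hb : BddAbove {t : ℕ | IsMinor (⊤ : SimpleGraph (Fin t)) G} :=
    ⟨Nat.card V, fun t ht => by simpa using IsMinor.card_le ht inferInstance⟩
  have hn : {t : ℕ | IsMinor (⊤ : SimpleGraph (Fin t)) G}.Nonempty :=
    ⟨0, isMinor_of_isEmpty _ _ G rfl⟩
  exact ⟨Nat.sSup_mem hn hb, fun t ht => le_csSup hb ht⟩

end SimpleGraph

/-!
Treewidth is minor-monotone: given disjoint connected branch sets in `H` representing `K`, replace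
every bag of a tree-decomposition of `H` by the set of branch sets that it meets. Since
`G ⊠ K_t` is a minor of `G ⊠ H` whenever `K_t` is a minor of `H`, it suffices to show
`tw(G ⊠ K_n) + 1 = (tw(G) + 1) n`. For `≤`, multiply every bag by `K_n`. For `≥`, keep in a
tree-decomposition of `G ⊠ K_n` those vertices `v` of `G` whose whole fibre `{v} × K_n` lies in the
bag. The fibres over one vertex or over the two ends of an edge form a clique, so by the Helly
property of subtrees they lie in a common bag, and the result is a tree-decomposition of `G` with
bags smaller by a factor `n`.
-/

namespace StrongProductTreewidth

open SimpleGraph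

variable {V W U ι : Type*}

/-! ### Connected induced subgraphs -/

theorem connected_induce_image {G : SimpleGraph V} {H : SimpleGraph W} (f : G →g H) {s : Set V}
    (hs : (G.induce s).Connected) : (H.induce (f '' s)).Connected :=
  hs.map (induceHom f (Set.mapsTo_image f s)) (Set.surjective_mapsTo_image_restrict f s)

/-- The condition on adjacent indices covers both sets that meet and sets joined by an edge. -/
theorem connected_induce_iUnion {K : SimpleGraph U} {G : SimpleGraph V} {S : U → Set V}
    (hK : K.Connected) (hS : ∀ u, (G.induce (S u)).Connected)
    (hadj : ∀ u u', K.Adj u u' → (G.induce (S u ∪ S u')).Connected) :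
    (G.induce (⋃ u, S u)).Connected := by
  have reachable_of_walk {u u' : U} (p : K.Walk u u') : ∀ x (hx : x ∈ S u) y (hy : y ∈ S u'),
      (G.induce (⋃ u, S u)).Reachable
        ⟨x, Set.mem_iUnion_of_mem u hx⟩ ⟨y, Set.mem_iUnion_of_mem u' hy⟩ := by
    induction p with
    | @nil u =>
      intro x hx y hy
      exact ((hS u).preconnected ⟨x, hx⟩ ⟨y, hy⟩).map
        (G.induceHomOfLE (Set.subset_iUnion S u)).toHom
    | @cons u w u' huw _ ih =>
      intro x hx y hy
      obtain ⟨⟨z, hz⟩⟩ := (hS w).nonempty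
      have hxz := ((hadj u w huw).preconnected ⟨x, .inl hx⟩ ⟨z, .inr hz⟩).map (G.induceHomOfLE
        (Set.union_subset (Set.subset_iUnion S u) (Set.subset_iUnion S w))).toHom
      exact hxz.trans (ih z hz y hy)
  obtain ⟨u⟩ := hK.nonempty
  obtain ⟨⟨x, hx⟩⟩ := (hS u).nonempty
  refine (connected_iff_exists_forall_reachable _).2 ⟨⟨x, Set.mem_iUnion_of_mem u hx⟩, ?_⟩
  rintro ⟨y, hy⟩
  obtain ⟨u', hyu'⟩ := Set.mem_iUnion.1 hy
  obtain ⟨p⟩ := hK.preconnected u u'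
  exact reachable_of_walk p x hx y hyu'

/-! ### Subtrees of a tree -/

section Subtrees

variable {T : SimpleGraph ι} {A B C S : Set ι}

theorem exists_isPath_support_subset (hS : (T.induce S).Preconnected) {x y : ι} (hx : x ∈ S)
    (hy : y ∈ S) : ∃ p : T.Walk x y, p.IsPath ∧ ∀ z ∈ p.support, z ∈ S := by
  obtain ⟨q, hq⟩ := hS.exists_isPath ⟨x, hx⟩ ⟨y, hy⟩
  let p : T.Walk x y := q.map (Embedding.induce S).toHom
  refine ⟨p, hq.map Subtype.val_injective, fun z hz => ?_⟩
  rw [show p.support = _ from Walk.support_map _ q, List.mem_map] at hz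
  obtain ⟨z, -, rfl⟩ := hz
  exact z.2

theorem support_subset_of_preconnected_induce (hT : T.IsAcyclic) (hS : (T.induce S).Preconnected)
    {x y : ι} (hx : x ∈ S) (hy : y ∈ S) {p : T.Walk x y} (hp : p.IsPath) :
    ∀ z ∈ p.support, z ∈ S := by
  obtain ⟨q, hq, hqS⟩ := exists_isPath_support_subset hS hx hy
  obtain rfl : p = q := congrArg Subtype.val ((hT.subsingleton_path x y).elim ⟨p, hp⟩ ⟨q, hq⟩)
  exact hqS

theorem preconnected_induce_iInter {κ : Type*} (hT : T.IsTree) {S : κ → Set ι}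
    (hS : ∀ k, (T.induce (S k)).Preconnected) : (T.induce (⋂ k, S k)).Preconnected := by
  rintro ⟨x, hx⟩ ⟨y, hy⟩
  obtain ⟨p, hp⟩ := hT.connected.preconnected.exists_isPath x y
  rw [Set.mem_iInter] at hx hy
  exact ⟨p.induce _ fun z hz => Set.mem_iInter.2 fun k =>
    support_subset_of_preconnected_induce hT.isAcyclic (hS k) (hx k) (hy k) hp z hz⟩

theorem preconnected_induce_inter (hT : T.IsTree) (hA : (T.induce A).Preconnected)
    (hB : (T.induce B).Preconnected) : (T.induce (A ∩ B)).Preconnected := by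
  rw [Set.inter_eq_iInter]
  exact preconnected_induce_iInter hT (Bool.rec hB hA)

theorem mem_or_mem_of_adj_of_inter_nonempty (hT : T.IsAcyclic) (hB : (T.induce B).Preconnected)
    (hC : (T.induce C).Preconnected) (hBC : (B ∩ C).Nonempty) {u v : ι} (hu : u ∈ B) (hv : v ∈ C)
    (huv : T.Adj u v) : v ∈ B ∨ u ∈ C := by
  obtain ⟨a, haB, haC⟩ := hBC
  obtain ⟨p, hp, hpB⟩ := exists_isPath_support_subset hB haB hu
  obtain ⟨q, hq, hqC⟩ := exists_isPath_support_subset hC haC hv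
  by_cases huq : u ∈ q.support
  · exact .inr (hqC u huq)
  · exact .inl (hpB v (hT.mem_support_of_ne_mem_support_of_adj_of_isPath hp hq huv huq))

theorem inter_inter_nonempty_of_pairwise (hT : T.IsTree) (hA : (T.induce A).Preconnected)
    (hB : (T.induce B).Preconnected) (hC : (T.induce C).Preconnected)
    (hAB : (A ∩ B).Nonempty) (hAC : (A ∩ C).Nonempty) (hBC : (B ∩ C).Nonempty) :
    (A ∩ B ∩ C).Nonempty := by
  obtain ⟨b, hbA, hbB⟩ := hAB
  obtain ⟨c, hcA, hcC⟩ := hAC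
  by_cases hbC : b ∈ C
  · exact ⟨b, ⟨hbA, hbB⟩, hbC⟩
  have hconn : (T.induce (A ∩ (B ∪ C))).Preconnected :=
    preconnected_induce_inter hT hA (induce_union_connected hB hC hBC).preconnected
  -- A walk from `c` to `b` inside `A ∩ (B ∪ C)` leaves `C` along an edge that has to lie in `B`.
  obtain ⟨p⟩ := hconn ⟨c, hcA, .inr hcC⟩ ⟨b, hbA, .inl hbB⟩
  obtain ⟨⟨⟨⟨v, hvA, _⟩, ⟨u, _, huBC⟩⟩, hvu⟩, -, hvC, huC⟩ :=
    p.exists_boundary_dart {x | x.1 ∈ C} hcC hbC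
  have huB : u ∈ B := huBC.resolve_right huC
  have hvB : v ∈ B := (mem_or_mem_of_adj_of_inter_nonempty hT.isAcyclic hB hC hBC huB hvC
    (induce_adj.1 hvu).symm).resolve_right huC
  exact ⟨v, ⟨hvA, hvB⟩, hvC⟩

theorem helly_property_of_isTree {κ : Type*} (hT : T.IsTree) (s : Finset κ) {S : κ → Set ι}
    (hS : ∀ k ∈ s, (T.induce (S k)).Preconnected)
    (hinter : ∀ k ∈ s, ∀ l ∈ s, (S k ∩ S l).Nonempty) : (⋂ k ∈ s, S k).Nonempty := by
  classical
  induction s using Finset.induction_on generalizing S with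
  | empty =>
    have := hT.connected.nonempty
    simp
  | insert a s _ ih =>
    simp only [Finset.forall_mem_insert] at hS hinter
    obtain ⟨hSa, hS⟩ := hS
    obtain ⟨⟨haa, ha⟩, hs⟩ := hinter
    rw [Finset.set_biInter_insert]
    rcases s.eq_empty_or_nonempty with rfl | hne
    · simpa using haa
    have hdistrib : S a ∩ ⋂ k ∈ s, S k = ⋂ k ∈ s, S a ∩ S k :=
      (Set.inter_biInter (Finset.coe_nonempty.2 hne) S (S a)).symm
    rw [hdistrib]
    refine ih (fun k hk => preconnected_induce_inter hT hSa (hS k hk)) fun k hk l hl => ?_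
    rw [← Set.inter_inter_distrib_left, ← Set.inter_assoc]
    exact inter_inter_nonempty_of_pairwise hT hSa (hS k hk) (hS l hl) (ha k hk) (ha l hl)
      ((hs k hk).2 l hl)

end Subtrees

/-! ### Tree-decompositions -/

theorem exists_bag_superset_of_isClique {G : SimpleGraph V} {T : SimpleGraph ι}
    (D : Decomposition G T) (hT : T.IsTree) {s : Finset V} (hs : G.IsClique s) :
    ∃ x, s ⊆ D.bag x := by
  obtain ⟨x, hx⟩ := helly_property_of_isTree hT s (S := fun v => {x | v ∈ D.bag x})
    (fun v _ => (D.connected v).preconnected) fun v hv w hw => by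
      obtain rfl | hvw := eq_or_ne v w
      · simpa using (Set.nonempty_coe_sort.1 (D.connected v).nonempty)
      · exact D.edge v w (hs hv hw hvw)
  exact ⟨x, fun v hv => Set.mem_iInter₂.1 hx v hv⟩

theorem exists_card_bag_le_treewidth_add_one [Finite V] (G : SimpleGraph V) :
    ∃ (m : ℕ) (T : SimpleGraph (Fin m)) (D : Decomposition G T), T.IsTree ∧
      ∀ x, ((D.bag x).card : ℤ) ≤ G.treewidth + 1 := by
  obtain ⟨m, T, D, hT, hD⟩ := G.isLeast_treewidth.1
  refine ⟨m, T, D, hT, fun x => ?_⟩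
  rw [← hD, Decomposition.width, sub_add_cancel, Nat.cast_le]
  exact Finset.le_sup (f := fun x => (D.bag x).card) (Finset.mem_univ x)

theorem exists_treewidth_add_one_le_card_bag {G : SimpleGraph V} {m : ℕ} {T : SimpleGraph (Fin m)}
    (D : Decomposition G T) (hT : T.IsTree) : ∃ x, G.treewidth + 1 ≤ (D.bag x).card := by
  have hbdd : BddBelow G.treeDecompositionWidths := by
    refine ⟨-1, ?_⟩
    rintro _ ⟨_, _, _, -, rfl⟩
    unfold Decomposition.width
    lia
  have hle : G.treewidth ≤ D.width := csInf_le hbdd ⟨m, T, D, hT, rfl⟩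
  have := hT.connected.nonempty
  obtain ⟨x, -, hx⟩ := Finset.exists_mem_eq_sup Finset.univ Finset.univ_nonempty
    fun x => (D.bag x).card
  refine ⟨x, ?_⟩
  rwa [Decomposition.width, hx, le_sub_iff_add_le] at hle

/-! ### Minors and treewidth -/

/-- A model of `K` as a minor of `H`: pairwise disjoint connected branch sets in `H`, one for each
vertex of `K`, such that branch sets of adjacent vertices are joined by an edge of `H`. -/
structure MinorModel (K : SimpleGraph U) (H : SimpleGraph W) where
  branch : U → Set W
  connected : ∀ u, (H.induce (branch u)).Connected
  eq_of_mem : ∀ {u u' w}, w ∈ branch u → w ∈ branch u' → u = u'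
  exists_adj : ∀ {u u'}, K.Adj u u' → ∃ w ∈ branch u, ∃ w' ∈ branch u', H.Adj w w'

namespace MinorModel

/-- The model of a subgraph, with singletons as branch sets. -/
def ofCopy {K : SimpleGraph U} {H : SimpleGraph W} (f : Copy K H) : MinorModel K H where
  branch u := {f u}
  connected u := by
    rw [induce_singleton_eq_top]
    exact connected_top
  eq_of_mem hu hu' := f.injective (hu.symm.trans hu')
  exists_adj h := ⟨_, rfl, _, rfl, f.toHom.map_adj h⟩

/-- The model of the contraction of the edge `ab`, in which `a` is represented by `{a, b}` and every
other vertex by itself. -/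
def ofContractEdge {H : SimpleGraph W} {a b : W} (hab : H.Adj a b) :
    MinorModel (H.contractEdge a b) H where
  branch u := {w | w = u ∨ u.1 = a ∧ w = b}
  connected := by
    rintro ⟨u, hu⟩
    obtain rfl | h := eq_or_ne u a
    · have hset : {w | w = u ∨ u = u ∧ w = b} = {u, b} := by ext; simp
      rw [hset]
      exact induce_pair_connected_of_adj hab
    · have hset : {w | w = u ∨ u = a ∧ w = b} = {u} := by ext; simp [h]
      rw [hset, induce_singleton_eq_top]
      exact connected_top
  eq_of_mem := by
    rintro ⟨u, hu⟩ ⟨u', hu'⟩ w (rfl | ⟨rfl, rfl⟩) (h | ⟨rfl, h⟩) <;> grind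
  exists_adj := by
    rintro u u' h
    obtain ⟨-, (h | ⟨hu, h⟩) | (h | ⟨hu', h⟩)⟩ := (fromRel_adj _ _ _).1 h
    · exact ⟨u, .inl rfl, u', .inl rfl, h⟩
    · exact ⟨b, .inr ⟨hu, rfl⟩, u', .inl rfl, h⟩
    · exact ⟨u, .inl rfl, u', .inl rfl, h.symm⟩
    · exact ⟨u, .inl rfl, b, .inr ⟨hu', rfl⟩, h.symm⟩

/-- Composition of models: a branch set is replaced by the union of the branch sets that represent
its vertices. -/
def trans {K : SimpleGraph U} {H : SimpleGraph W} {G : SimpleGraph V} (M : MinorModel K H)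
    (N : MinorModel H G) : MinorModel K G where
  branch u := ⋃ w : M.branch u, N.branch w
  connected u := by
    refine connected_induce_iUnion (M.connected u) (fun w => N.connected w) fun w w' h => ?_
    obtain ⟨v, hv, v', hv', hvv'⟩ := N.exists_adj (induce_adj.1 h)
    exact connected_induce_union (N.connected w).preconnected (N.connected w').preconnected
      hv hv' hvv'
  eq_of_mem hu hu' := by
    obtain ⟨⟨w, hw⟩, hvw⟩ := Set.mem_iUnion.1 hu
    obtain ⟨⟨w', hw'⟩, hvw'⟩ := Set.mem_iUnion.1 hu'
    obtain rfl : w = w' := N.eq_of_mem hvw hvw'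
    exact M.eq_of_mem hw hw'
  exists_adj h := by
    obtain ⟨w, hw, w', hw', hww'⟩ := M.exists_adj h
    obtain ⟨v, hv, v', hv', hvv'⟩ := N.exists_adj hww'
    exact ⟨v, Set.mem_iUnion_of_mem ⟨w, hw⟩ hv, v', Set.mem_iUnion_of_mem ⟨w', hw'⟩ hv', hvv'⟩

theorem finite_setOf_branch_inter_nonempty {K : SimpleGraph U} {H : SimpleGraph W}
    (M : MinorModel K H) {s : Set W} (hs : s.Finite) : {u | (M.branch u ∩ s).Nonempty}.Finite := by
  have hunion : {u | (M.branch u ∩ s).Nonempty} = ⋃ w ∈ s, {u | w ∈ M.branch u} := by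
    ext u
    simp [Set.Nonempty, and_comm]
  rw [hunion]
  exact hs.biUnion fun w _ => Set.Subsingleton.finite fun u hu u' hu' => M.eq_of_mem hu hu'

/-- The decomposition of a minor `K` of `H` induced by a decomposition of `H`: a bag consists of the
vertices of `K` whose branch sets meet the original bag. -/
noncomputable def decomposition {K : SimpleGraph U} {H : SimpleGraph W} (M : MinorModel K H)
    {T : SimpleGraph ι} (D : Decomposition H T) : Decomposition K T where
  bag x := (M.finite_setOf_branch_inter_nonempty (D.bag x).finite_toSet).toFinset
  connected u := by
    have hunion :
        {x | u ∈ (M.finite_setOf_branch_inter_nonempty (D.bag x).finite_toSet).toFinset} =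
          ⋃ w : M.branch u, {x | (w : W) ∈ D.bag x} := by
      ext x
      simp [Set.Nonempty]
    rw [hunion]
    exact connected_induce_iUnion (M.connected u) (fun w => D.connected w)
      fun w w' h => induce_union_connected (D.connected w).preconnected
        (D.connected w').preconnected (D.edge w w' (induce_adj.1 h))
  edge u u' h := by
    obtain ⟨w, hw, w', hw', hww'⟩ := M.exists_adj h
    obtain ⟨x, hx, hx'⟩ := D.edge w w' hww'
    simp only [Set.Finite.mem_toFinset]
    exact ⟨x, ⟨w, hw, hx⟩, w', hw', hx'⟩

theorem card_bag_decomposition_le {K : SimpleGraph U} {H : SimpleGraph W} (M : MinorModel K H)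
    {T : SimpleGraph ι} (D : Decomposition H T) (x : ι) :
    ((M.decomposition D).bag x).card ≤ (D.bag x).card := by
  refine Finset.card_le_card_of_forall_subsingleton (fun u w => w ∈ M.branch u) (fun u hu => ?_)
    fun w _ u hu u' hu' => M.eq_of_mem hu.2 hu'.2
  obtain ⟨w, hw, hwx⟩ := (Set.Finite.mem_toFinset _).1 hu
  exact ⟨w, hwx, hw⟩

theorem treewidth_le [Finite W] {K : SimpleGraph U} {H : SimpleGraph W} (M : MinorModel K H) :
    K.treewidth ≤ H.treewidth := by
  obtain ⟨m, T, D, hT, hD⟩ := exists_card_bag_le_treewidth_add_one H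
  obtain ⟨x, hx⟩ := exists_treewidth_add_one_le_card_bag (M.decomposition D) hT
  have hcard : (((M.decomposition D).bag x).card : ℤ) ≤ (D.bag x).card :=
    mod_cast M.card_bag_decomposition_le D x
  linarith [hD x]

end MinorModel

theorem nonempty_minorModel_of_isMinor {K : SimpleGraph U} {H : SimpleGraph W}
    (h : IsMinor K H) : Nonempty (MinorModel K H) := by
  induction h with
  | iso e => exact ⟨.ofCopy e.toCopy⟩
  | deleteVertex a _ ih => exact ih.map fun M => M.trans (.ofCopy (Copy.induce _ _))
  | deleteEdge a b _ _ ih =>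
    exact ih.map fun M => M.trans (.ofCopy (Copy.ofLE _ _ (deleteEdges_le _)))
  | contractEdge a b hab _ ih => exact ih.map fun M => M.trans (.ofContractEdge hab)

/-! ### Strong products -/

theorem strongProd_adj {G : SimpleGraph V} {H : SimpleGraph W} {p q : V × W} :
    (G.strongProd H).Adj p q ↔
      p ≠ q ∧ (p.1 = q.1 ∨ G.Adj p.1 q.1) ∧ (p.2 = q.2 ∨ H.Adj p.2 q.2) := by
  have hG : G.Adj p.1 q.1 → p.1 ≠ q.1 := Adj.ne
  have hH : H.Adj p.2 q.2 → p.2 ≠ q.2 := Adj.ne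
  simp only [strongProd, directProd, sup_adj, boxProd_adj, ne_eq, Prod.ext_iff]
  tauto

theorem isClique_strongProd_product {G : SimpleGraph V} {H : SimpleGraph W} {s : Finset V}
    {t : Finset W} (hs : G.IsClique s) (ht : H.IsClique t) :
    (G.strongProd H).IsClique (s ×ˢ t : Finset (V × W)) := by
  intro p hp q hq hpq
  rw [Finset.mem_coe, Finset.mem_product] at hp hq
  exact strongProd_adj.2 ⟨hpq, or_iff_not_imp_left.2 (hs hp.1 hq.1),
    or_iff_not_imp_left.2 (ht hp.2 hq.2)⟩

/-- The embedding of `H` as the fibre over a vertex `v` of `G`. -/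
def strongProdFiberHom (G : SimpleGraph V) (H : SimpleGraph W) (v : V) : H →g G.strongProd H where
  toFun w := (v, w)
  map_rel' h := strongProd_adj.2 ⟨fun e => h.ne (congrArg Prod.snd e), .inl rfl, .inr h⟩

/-- The model of `G ⊠ K` in `G ⊠ H` given by a model of `K` in `H`. -/
def MinorModel.strongProd (G : SimpleGraph V) {K : SimpleGraph U} {H : SimpleGraph W}
    (M : MinorModel K H) : MinorModel (G.strongProd K) (G.strongProd H) where
  branch p := strongProdFiberHom G H p.1 '' M.branch p.2
  connected p := connected_induce_image _ (M.connected p.2)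
  eq_of_mem := by
    rintro ⟨v, u⟩ ⟨v', u'⟩ _ ⟨w, hw, rfl⟩ ⟨w', hw', h⟩
    obtain ⟨rfl, rfl⟩ := Prod.mk.inj h
    exact Prod.ext rfl (M.eq_of_mem hw hw')
  exists_adj := by
    rintro ⟨v, u⟩ ⟨v', u'⟩ h
    obtain ⟨hne, hv, rfl | hu⟩ := strongProd_adj.1 h
    · obtain ⟨⟨w, hw⟩⟩ := (M.connected u).nonempty
      refine ⟨(v, w), ⟨w, hw, rfl⟩, (v', w), ⟨w, hw, rfl⟩, strongProd_adj.2 ⟨?_, hv, .inl rfl⟩⟩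
      simpa using hne
    · obtain ⟨w, hw, w', hw', hww'⟩ := M.exists_adj hu
      exact ⟨(v, w), ⟨w, hw, rfl⟩, (v', w'), ⟨w', hw', rfl⟩,
        strongProd_adj.2 ⟨fun e => hww'.ne (congrArg Prod.snd e), hv, .inr hww'⟩⟩

/-- The decomposition of `G ⊠ H` whose bags are those of `G` multiplied by all of `H`. -/
def blowUpDecomposition [Fintype W] {G : SimpleGraph V} (H : SimpleGraph W) {T : SimpleGraph ι}
    (D : Decomposition G T) : Decomposition (G.strongProd H) T where
  bag x := D.bag x ×ˢ Finset.univ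
  connected p := by
    have hset : {x | p ∈ D.bag x ×ˢ Finset.univ} = {x | p.1 ∈ D.bag x} := by ext; simp
    rw [hset]
    exact D.connected p.1
  edge p q h := by
    simp only [Finset.mem_product, Finset.mem_univ, and_true]
    obtain hpq | hpq := (strongProd_adj.1 h).2.1
    · obtain ⟨⟨x, hx⟩⟩ := (D.connected p.1).nonempty
      exact ⟨x, hx, hpq ▸ hx⟩
    · exact D.edge p.1 q.1 hpq

theorem treewidth_strongProd_add_one_le [Finite V] [Fintype W] (G : SimpleGraph V)
    (H : SimpleGraph W) :
    (G.strongProd H).treewidth + 1 ≤ (G.treewidth + 1) * Fintype.card W := by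
  obtain ⟨m, T, D, hT, hD⟩ := exists_card_bag_le_treewidth_add_one G
  obtain ⟨x, hx⟩ := exists_treewidth_add_one_le_card_bag (blowUpDecomposition H D) hT
  calc (G.strongProd H).treewidth + 1
      ≤ ((D.bag x).card : ℤ) * Fintype.card W := by simpa [blowUpDecomposition] using hx
    _ ≤ (G.treewidth + 1) * Fintype.card W := by gcongr; exact hD x

theorem exists_fibers_subset_bag [Finite W] {G : SimpleGraph V} {T : SimpleGraph ι}
    (hT : T.IsTree) (D : Decomposition (G.strongProd (⊤ : SimpleGraph W)) T) {s : Finset V}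
    (hs : G.IsClique s) : ∃ x, ∀ v ∈ s, ∀ w, (v, w) ∈ D.bag x := by
  have := Fintype.ofFinite W
  obtain ⟨x, hx⟩ := exists_bag_superset_of_isClique D hT
    (isClique_strongProd_product hs (t := Finset.univ) (fun _ _ _ _ h => h))
  exact ⟨x, fun v hv w => hx (Finset.mk_mem_product hv (Finset.mem_univ w))⟩

/-- The decomposition of `G` induced by a tree-decomposition of `G ⊠ K`, for a complete graph `K`: a
bag consists of the vertices whose whole fibre lies in the original bag. -/
noncomputable def fiberDecomposition [Finite V] [Finite W] {G : SimpleGraph V}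
    {T : SimpleGraph ι} (hT : T.IsTree)
    (D : Decomposition (G.strongProd (⊤ : SimpleGraph W)) T) : Decomposition G T where
  bag x := (Set.toFinite {v | ∀ w, (v, w) ∈ D.bag x}).toFinset
  connected v := by
    obtain ⟨x, hx⟩ := exists_fibers_subset_bag hT D (s := {v}) (by simp)
    have hinter : (T.induce (⋂ w, {x | (v, w) ∈ D.bag x})).Preconnected :=
      preconnected_induce_iInter hT fun w => (D.connected (v, w)).preconnected
    have hset : {x | v ∈ (Set.toFinite {v | ∀ w, (v, w) ∈ D.bag x}).toFinset} =
        ⋂ w, {x | (v, w) ∈ D.bag x} := by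
      ext x
      simp
    rw [hset]
    have : Nonempty ↥(⋂ w, {x | (v, w) ∈ D.bag x}) :=
      ⟨x, Set.mem_iInter.2 (hx v (by simp))⟩
    exact ⟨hinter⟩
  edge v v' h := by
    classical
    obtain ⟨x, hx⟩ := exists_fibers_subset_bag hT D (s := {v, v'}) (by simp [h])
    exact ⟨x, by simpa using hx v (by simp), by simpa using hx v' (by simp)⟩

theorem card_bag_fiberDecomposition_mul_le [Finite V] [Fintype W] {G : SimpleGraph V}
    {T : SimpleGraph ι} (hT : T.IsTree) (D : Decomposition (G.strongProd (⊤ : SimpleGraph W)) T)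
    (x : ι) : ((fiberDecomposition hT D).bag x).card * Fintype.card W ≤ (D.bag x).card := by
  rw [← Finset.card_univ, ← Finset.card_product]
  refine Finset.card_le_card fun p hp => ?_
  have hfiber : ∀ w, (p.1, w) ∈ D.bag x := by simpa [fiberDecomposition] using hp
  exact hfiber p.2

theorem treewidth_strongProd_top [Finite V] [Fintype W] (G : SimpleGraph V) :
    (G.strongProd (⊤ : SimpleGraph W)).treewidth = (G.treewidth + 1) * Fintype.card W - 1 := by
  refine le_antisymm (le_sub_iff_add_le.2 (treewidth_strongProd_add_one_le G ⊤))
    (sub_le_iff_le_add.2 ?_)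
  obtain ⟨m, T, D, hT, hD⟩ :=
    exists_card_bag_le_treewidth_add_one (G.strongProd (⊤ : SimpleGraph W))
  obtain ⟨x, hx⟩ := exists_treewidth_add_one_le_card_bag (fiberDecomposition hT D) hT
  calc (G.treewidth + 1) * Fintype.card W
      ≤ ((fiberDecomposition hT D).bag x).card * Fintype.card W := by gcongr
    _ ≤ ((D.bag x).card : ℤ) := mod_cast card_bag_fiberDecomposition_mul_le hT D x
    _ ≤ _ := hD x

end StrongProductTreewidth

theorem mainTheorem6 {V : Type u} [Finite V] (G : SimpleGraph V) :
    (∀ {W : Type v} [Finite W] (H : SimpleGraph W),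
      (G.strongProd H).treewidth ≥ (H.hadwigerNumber : ℤ) * (G.treewidth + 1) - 1) ∧
    ∀ n : ℕ, (G.strongProd (⊤ : SimpleGraph (Fin n))).treewidth = (G.treewidth + 1) * n - 1 := by
  refine ⟨fun H => ?_, fun n => by
    simpa using StrongProductTreewidth.treewidth_strongProd_top (W := Fin n) G⟩
  obtain ⟨M⟩ := StrongProductTreewidth.nonempty_minorModel_of_isMinor H.isGreatest_hadwigerNumber.1
  calc (H.hadwigerNumber : ℤ) * (G.treewidth + 1) - 1
      = (G.strongProd (⊤ : SimpleGraph (Fin H.hadwigerNumber))).treewidth := by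
        rw [StrongProductTreewidth.treewidth_strongProd_top, Fintype.card_fin, mul_comm]
    _ ≤ (G.strongProd H).treewidth := (M.strongProd G).treewidth_le
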